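/- Let $r=2^2/3^3=4/27$, and let $(s,c)$ be the (unique) pair of holomorphic functions on the disc $|z|<r$ that satisfies $s'=c^3$, $c'=-s^3$, $s(0)=0$, $c(0)=1$. Then for all complex $z$ with $|z|<r$, $$s(z)\,c(z)=\tfrac{1}{\sqrt2}\,\mathrm{sl}(\sqrt2\,z)=\tfrac12\,\mathrm{sd}(2z).$$ Here $\mathrm{sl}$ is Gauss's lemniscatic sine, the meromorphic function on $\mathbb{C}$ that near $0$ is the inverse of $w\mapsto\int_0^w\frac{dt}{\sqrt{1-t^4}}$, and $\mathrm{sd}=\mathrm{sn}/\mathrm{dn}$ is the Glaisher quotient of the Jacobian elliptic functions with modulus $k=1/\sqrt2$: $\mathrm{sn}$ is the meromorphic function on $\mathbb{C}$ that near $0$ is the inverse of $w\mapsto\int_0^w\frac{dt}{\sqrt{(1-t^2)(1-k^2t^2)}}$, and $\mathrm{dn}$ is the meromorphic function on $\mathbb{C}$ with $\mathrm{dn}^2=1-k^2\,\mathrm{sn}^2$ and $\mathrm{dn}(0)=1$. -/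

import Mathlib

/-- The pair `(s, c)` is a holomorphic solution on the open set `U` (containing `0`) of the
initial value problem `s' = c ^ 3`, `c' = - s ^ 3`, `s 0 = 0`, `c 0 = 1`. -/
structure IsCubicSolutionOn (s c : ℂ → ℂ) (U : Set ℂ) : Prop where
  deriv_s : ∀ z ∈ U, HasDerivAt s (c z ^ 3) z
  deriv_c : ∀ z ∈ U, HasDerivAt c (-(s z ^ 3)) z
  s_zero : s 0 = 0
  c_zero : c 0 = 1

/-- The integral of `φ` along the straight segment from `0` to `w` in the complex plane. -/
noncomputable def segmentIntegral (φ : ℂ → ℂ) (w : ℂ) : ℂ :=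
  ∫ t in (0 : ℝ)..1, w * φ ((t : ℂ) * w)

/-- The meromorphic continuation to `ℂ` of (the germ at `0` of) the function `f`.
It is unique if it exists, since functions in meromorphic normal form (equal to their analytic
value at regular points and removable singularities, and to `0` at poles) that agree near `0`
agree everywhere. If there is none, the function `f` is left as it is. -/
noncomputable def meromorphicContinuation (f : ℂ → ℂ) : ℂ → ℂ :=
  open Classical in
  if h : ∃ g : ℂ → ℂ, MeromorphicNFOn g Set.univ ∧ g =ᶠ[nhds 0] f then h.choose else f

/-- The lemniscatic integral `∫₀ʷ dt / √(1 - t⁴)`, with the principal square root, for `|w| < 1`. -/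
noncomputable def arcsl (w : ℂ) : ℂ :=
  segmentIntegral (fun t => (1 - t ^ 4) ^ (-(1 / 2) : ℂ)) w

/-- Gauss's lemniscatic sine: the meromorphic function on `ℂ` that arises by inversion of the
lemniscatic integral. (On the open unit disc this integral is injective, as its derivative has
positive real part there.) -/
noncomputable def sl : ℂ → ℂ :=
  meromorphicContinuation (Function.invFunOn arcsl (Metric.ball 0 1))

/-- Legendre's elliptic integral of the first kind with modulus `k ∈ (0, 1)`,
`∫₀ʷ dt / (√(1 - t²) √(1 - k² t²))`, with the principal square roots, for `|w| < 1`. -/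
noncomputable def ellipticIntegralF (k : ℝ) (w : ℂ) : ℂ :=
  segmentIntegral
    (fun t => (1 - t ^ 2) ^ (-(1 / 2) : ℂ) * (1 - (k : ℂ) ^ 2 * t ^ 2) ^ (-(1 / 2) : ℂ)) w

/-- The Jacobian elliptic function `sn` with modulus `k ∈ (0, 1)`: the meromorphic function on `ℂ`
that arises by inversion of the elliptic integral of the first kind. (On the open unit disc this
integral is injective, as its derivative has positive real part there.) -/
noncomputable def jacobiSn (k : ℝ) : ℂ → ℂ :=
  meromorphicContinuation (Function.invFunOn (ellipticIntegralF k) (Metric.ball 0 1))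

/-- The Jacobian elliptic function `dn` with modulus `k ∈ (0, 1)`: the meromorphic function on `ℂ`
with `dn² = 1 - k² sn²` and `dn 0 = 1`. -/
noncomputable def jacobiDn (k : ℝ) : ℂ → ℂ :=
  meromorphicContinuation (fun u => (1 - (k : ℂ) ^ 2 * jacobiSn k u ^ 2) ^ (1 / 2 : ℂ))

/-- Glaisher's quotient `sd = sn / dn` with modulus `k ∈ (0, 1)`, as a meromorphic function on `ℂ`
(the continuation of the quotient from a neighbourhood of `0` also gives the right values at the
common poles of `sn` and `dn`, where the quotient has removable singularities). -/
noncomputable def jacobiSd (k : ℝ) : ℂ → ℂ :=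
  meromorphicContinuation (fun u => jacobiSn k u / jacobiDn k u)

/-!
Since `c ^ 4 + s ^ 4` is constant, `q = s * c` satisfies `q' = c ^ 4 - s ^ 4` and hence
`q' ^ 2 = 1 - 4 * q ^ 4` with `q 0 = 0`, `q' 0 = 1`. Such an equation determines the germ of `q` as
the inverse of an integral: rescaling by `√2` gives the lemniscatic one, while `y u = 2 * q (u / 2)`
satisfies `y' ^ 2 = (1 - k'² y²) (1 + k² y²)` for `k² = k'² = 1 / 2`, the equation of `sd`. The
latter is reduced to the equation of `sn` by the substitutions `sn = sd / √(1 + k² sd²)` and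
`dn = 1 / √(1 + k² sd²)`. Finally, the duplication formula `q (2 v) = 2 q q' / (1 + 4 q ^ 4)`
extends the germ of `q` to a meromorphic function on `ℂ`, so that the identities between germs
propagate by the identity theorem.
-/

open Set Filter Metric Topology

section Inversion

theorem eventuallyEq_of_sq_eq_sq {X R : Type*} [TopologicalSpace X] [TopologicalSpace R]
    [CommRing R] [NoZeroDivisors R] [NeZero (2 : R)] [ContinuousAdd R] [T1Space R] {f g : X → R}
    {x : X} (hf : ContinuousAt f x) (hg : ContinuousAt g x) (hfg : f x = g x) (hgx : g x ≠ 0)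
    (hsq : ∀ᶠ y in 𝓝 x, f y ^ 2 = g y ^ 2) : f =ᶠ[𝓝 x] g := by
  have hadd : ∀ᶠ y in 𝓝 x, f y + g y ≠ 0 := by
    refine (hf.add hg).eventually_ne ?_
    rw [Pi.add_apply, hfg, ← two_mul]
    exact mul_ne_zero two_ne_zero hgx
  filter_upwards [hsq, hadd] with y hy hy'
  exact (sq_eq_sq_iff_eq_or_eq_neg.1 hy).resolve_right fun h => hy' (by rw [h, neg_add_cancel])

theorem eventuallyEq_of_eventually_hasDerivAt {𝕜 E : Type*} [RCLike 𝕜] [NormedAddCommGroup E]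
    [NormedSpace 𝕜 E] {f g f' : 𝕜 → E} {x : 𝕜} (hf : ∀ᶠ y in 𝓝 x, HasDerivAt f (f' y) y)
    (hg : ∀ᶠ y in 𝓝 x, HasDerivAt g (f' y) y) (hfg : f x = g x) : f =ᶠ[𝓝 x] g := by
  obtain ⟨ε, hε, h⟩ := Metric.eventually_nhds_iff_ball.1 (hf.and hg)
  have heq : EqOn f g (ball x ε) :=
    isOpen_ball.eqOn_of_deriv_eq (convex_ball x ε).isPreconnected
      (fun y hy => (h y hy).1.differentiableAt.differentiableWithinAt)
      (fun y hy => (h y hy).2.differentiableAt.differentiableWithinAt)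
      (fun y hy => (h y hy).1.deriv.trans (h y hy).2.deriv.symm) (mem_ball_self hε) hfg
  exact heq.eventuallyEq_of_mem (ball_mem_nhds x hε)

theorem injOn_of_convex_of_re_deriv_pos {f f' : ℂ → ℂ} {U : Set ℂ} (hU : Convex ℝ U)
    (hf : ∀ z ∈ U, HasDerivAt f (f' z) z) (hpos : ∀ z ∈ U, 0 < (f' z).re) : InjOn f U := by
  intro a ha b hb hab
  by_contra hne
  have hmem : ∀ t ∈ Icc (0 : ℝ) 1, a + (t : ℂ) * (b - a) ∈ U := fun t ht => by
    simpa using hU.add_smul_sub_mem ha hb ht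
  -- The real part of `f / (b - a)` is strictly increasing along the segment from `a` to `b`.
  have hderiv : ∀ t ∈ Icc (0 : ℝ) 1,
      HasDerivAt (fun t : ℝ => (f (a + (t : ℂ) * (b - a)) / (b - a)).re)
        (f' (a + (t : ℂ) * (b - a))).re t := by
    intro t ht
    have hline : HasDerivAt (fun t : ℂ => a + t * (b - a)) (b - a) (t : ℂ) := by
      simpa using ((hasDerivAt_id (t : ℂ)).mul_const (b - a)).const_add a
    have hdiv := ((hf _ (hmem t ht)).comp (t : ℂ) hline).div_const (b - a)
    rw [mul_div_cancel_right₀ _ (sub_ne_zero.2 (Ne.symm hne))] at hdiv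
    exact hdiv.real_of_complex
  have hmono := strictMonoOn_of_deriv_pos (convex_Icc (0 : ℝ) 1)
    (fun t ht => (hderiv t ht).continuousAt.continuousWithinAt) fun t ht => by
      have ht' := interior_subset ht
      rw [(hderiv t ht').deriv]
      exact hpos _ (hmem t ht')
  have hlt := hmono (left_mem_Icc.2 zero_le_one) (right_mem_Icc.2 zero_le_one) zero_lt_one
  simp [hab] at hlt

theorem segmentIntegral_eq_sub {φ Φ : ℂ → ℂ} {U : Set ℂ} (hU : StarConvex ℝ 0 U)
    (hΦ : ∀ z ∈ U, HasDerivAt Φ (φ z) z) (hφ : ContinuousOn φ U) {w : ℂ} (hw : w ∈ U) :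
    segmentIntegral φ w = Φ w - Φ 0 := by
  have hmem : ∀ t ∈ uIcc (0 : ℝ) 1, (t : ℂ) * w ∈ U := fun t ht => by
    rw [uIcc_of_le zero_le_one] at ht
    simpa using hU.smul_mem hw ht.1 ht.2
  have hderiv : ∀ t ∈ uIcc (0 : ℝ) 1,
      HasDerivAt (fun t : ℝ => Φ ((t : ℂ) * w)) (w * φ ((t : ℂ) * w)) t := fun t ht => by
    rw [mul_comm]
    exact ((hΦ _ (hmem t ht)).comp (t : ℂ) (hasDerivAt_mul_const w)).comp_ofReal
  have hcont : ContinuousOn (fun t : ℝ => w * φ ((t : ℂ) * w)) (uIcc 0 1) :=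
    continuousOn_const.mul (hφ.comp (by fun_prop) hmem)
  simpa [segmentIntegral] using
    intervalIntegral.integral_eq_sub_of_hasDerivAt hderiv hcont.intervalIntegrable

theorem hasDerivAt_segmentIntegral {φ : ℂ → ℂ} {r : ℝ} (hφ : DifferentiableOn ℂ φ (ball 0 r))
    {w : ℂ} (hw : w ∈ ball (0 : ℂ) r) : HasDerivAt (segmentIntegral φ) (φ w) w := by
  obtain ⟨Φ, hΦ⟩ := hφ.isExactOn_ball
  have hstar : StarConvex ℝ 0 (ball (0 : ℂ) r) :=
    (convex_ball 0 r).starConvex (mem_ball_self (pos_of_mem_ball hw))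
  refine ((hΦ w hw).sub_const (Φ 0)).congr_of_eventuallyEq ?_
  filter_upwards [isOpen_ball.mem_nhds hw] with z hz
  exact segmentIntegral_eq_sub hstar hΦ hφ.continuousOn hz

theorem invFunOn_segmentIntegral_eventuallyEq {φ p : ℂ → ℂ} {r : ℝ} (hr : 0 < r)
    (hφ : DifferentiableOn ℂ φ (ball 0 r)) (hre : ∀ z ∈ ball (0 : ℂ) r, 0 < (φ z).re)
    (hp0 : p 0 = 0) (hp : ∀ᶠ v in 𝓝 0, HasDerivAt p (φ (p v))⁻¹ v) :
    Function.invFunOn (segmentIntegral φ) (ball 0 r) =ᶠ[𝓝 0] p := by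
  have hinj : InjOn (segmentIntegral φ) (ball 0 r) :=
    injOn_of_convex_of_re_deriv_pos (convex_ball 0 r)
      (fun _ hz => hasDerivAt_segmentIntegral hφ hz) hre
  have hball : ∀ᶠ v in 𝓝 0, p v ∈ ball (0 : ℂ) r :=
    hp.self_of_nhds.continuousAt.eventually_mem (by rw [hp0]; exact ball_mem_nhds 0 hr)
  have hcomp : ∀ᶠ v in 𝓝 0, HasDerivAt (fun v => segmentIntegral φ (p v)) 1 v := by
    filter_upwards [hp, hball] with v hv hvr
    have hne : φ (p v) ≠ 0 := fun h => by simpa [h] using hre _ hvr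
    have hderiv := (hasDerivAt_segmentIntegral hφ hvr).comp v hv
    rwa [mul_inv_cancel₀ hne] at hderiv
  have hid : (fun v => segmentIntegral φ (p v)) =ᶠ[𝓝 0] id :=
    eventuallyEq_of_eventually_hasDerivAt hcomp (.of_forall hasDerivAt_id)
      (by simp [hp0, segmentIntegral])
  filter_upwards [hid, hball] with v hv hvr
  simpa only [hv, id_eq] using hinj.leftInvOn_invFunOn hvr

end Inversion

section CpowNegHalf

theorem cpow_neg_half_sq (x : ℂ) : (x ^ (-(1 / 2) : ℂ)) ^ 2 = x⁻¹ := by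
  rw [← Complex.cpow_nat_mul]
  norm_num [Complex.cpow_neg_one]

theorem re_cpow_neg_half_mul_pos {x y : ℂ} (hx : 0 < x.re) (hy : 0 < y.re) :
    0 < (x ^ (-(1 / 2) : ℂ) * y ^ (-(1 / 2) : ℂ)).re := by
  have hx0 : x ≠ 0 := by rintro rfl; simp at hx
  have hy0 : y ≠ 0 := by rintro rfl; simp at hy
  have harg_x := abs_lt.1 (Complex.abs_arg_lt_pi_div_two_iff.2 (.inl hx))
  have harg_y := abs_lt.1 (Complex.abs_arg_lt_pi_div_two_iff.2 (.inl hy))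
  have him : (Complex.log x * -(1 / 2) + Complex.log y * -(1 / 2)).im = -(x.arg + y.arg) / 2 := by
    have hhalf : (-(1 / 2) : ℂ) = ((-(1 / 2) : ℝ) : ℂ) := by push_cast; rfl
    rw [hhalf, Complex.add_im, Complex.im_mul_ofReal, Complex.im_mul_ofReal, Complex.log_im,
      Complex.log_im]
    ring
  rw [Complex.cpow_def_of_ne_zero hx0, Complex.cpow_def_of_ne_zero hy0, ← Complex.exp_add,
    Complex.exp_re, him]
  exact mul_pos (Real.exp_pos _) (Real.cos_pos_of_mem_Ioo ⟨by linarith, by linarith⟩)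

theorem re_cpow_neg_half_pos {x : ℂ} (hx : 0 < x.re) : 0 < (x ^ (-(1 / 2) : ℂ)).re := by
  simpa using re_cpow_neg_half_mul_pos hx (y := 1) (by simp)

theorem inv_cpow_half {x : ℂ} (hx : 0 < x.re) : x⁻¹ ^ (1 / 2 : ℂ) = x ^ (-(1 / 2) : ℂ) := by
  have harg : x.arg ≠ Real.pi := fun h => by
    have := (Complex.arg_eq_pi_iff.1 h).1
    linarith
  rw [Complex.inv_cpow _ _ harg, Complex.cpow_neg]

theorem re_one_sub_mul_pow_pos {a z : ℂ} {n : ℕ} (hn : n ≠ 0) (ha : ‖a‖ ≤ 1) (hz : ‖z‖ < 1) :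
    0 < (1 - a * z ^ n).re := by
  have hnorm : ‖a * z ^ n‖ < 1 := by
    rw [norm_mul, norm_pow]
    exact mul_lt_one_of_nonneg_of_lt_one_right ha (by positivity)
      (pow_lt_one₀ (norm_nonneg z) hz hn)
  simpa using (Complex.re_le_norm _).trans_lt hnorm

end CpowNegHalf

/-- The germ at `0` of `p` is an analytic solution of `p' ^ 2 = P ∘ p` with `p 0 = 0`, i.e. it is
the inverse of `w ↦ ∫₀ʷ dt / √(P t)`, where `p' 0 = 1` selects the branch of the square root. -/
structure IsInversionGerm (P p : ℂ → ℂ) : Prop where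
  analyticAt : AnalyticAt ℂ p 0
  map_zero : p 0 = 0
  deriv_zero : deriv p 0 = 1
  deriv_sq : ∀ᶠ v in 𝓝 0, deriv p v ^ 2 = P (p v)

namespace IsInversionGerm

variable {P p φ : ℂ → ℂ}

theorem of_eventually_hasDerivAt {p' : ℂ → ℂ} (hp : ∀ᶠ v in 𝓝 0, HasDerivAt p (p' v) v)
    (hp0 : p 0 = 0) (hderiv0 : p' 0 = 1) (hsq : ∀ᶠ v in 𝓝 0, p' v ^ 2 = P (p v)) :
    IsInversionGerm P p where
  analyticAt := Complex.analyticAt_iff_eventually_differentiableAt.2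
    (hp.mono fun _ hv => hv.differentiableAt)
  map_zero := hp0
  deriv_zero := hp.self_of_nhds.deriv.trans hderiv0
  deriv_sq := by
    filter_upwards [hp, hsq] with v hv hv'
    rw [hv.deriv, hv']

theorem eventually_hasDerivAt (h : IsInversionGerm P p) :
    ∀ᶠ v in 𝓝 0, HasDerivAt p (deriv p v) v :=
  h.analyticAt.eventually_analyticAt.mono fun _ hv => hv.differentiableAt.hasDerivAt

theorem tendsto (h : IsInversionGerm P p) : Tendsto p (𝓝 0) (𝓝 0) := by
  simpa only [ContinuousAt, h.map_zero] using h.analyticAt.continuousAt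

theorem eventually_hasDerivAt_deriv {P' : ℂ → ℂ} (h : IsInversionGerm P p)
    (hP : ∀ᶠ x in 𝓝 0, HasDerivAt P (P' x) x) :
    ∀ᶠ v in 𝓝 0, HasDerivAt (deriv p) (P' (p v) / 2) v := by
  have hne : ∀ᶠ v in 𝓝 0, deriv p v ≠ 0 :=
    h.analyticAt.deriv.continuousAt.eventually_ne (by simp [h.deriv_zero])
  filter_upwards [h.eventually_hasDerivAt, h.analyticAt.deriv.eventually_analyticAt, hne,
    h.deriv_sq.eventually_nhds, h.tendsto.eventually hP] with v hp hp' hv hsq hPv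
  have hderiv := hp'.differentiableAt.hasDerivAt
  have hdiff : 2 * deriv p v * deriv (deriv p) v = P' (p v) * deriv p v := by
    simpa using (hderiv.pow 2).unique ((hPv.comp v hp).congr_of_eventuallyEq hsq)
  refine hderiv.congr_deriv ?_
  rw [eq_div_iff two_ne_zero]
  exact mul_right_cancel₀ hv (by linear_combination hdiff)

theorem scale (h : IsInversionGerm P p) {a : ℂ} (ha : a ≠ 0) :
    IsInversionGerm (fun x => P (a⁻¹ * x)) (fun u => a * p (a⁻¹ * u)) := by
  have htendsto : Tendsto (fun u : ℂ => a⁻¹ * u) (𝓝 0) (𝓝 0) :=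
    (continuous_const_mul a⁻¹).tendsto' 0 0 (mul_zero _)
  refine of_eventually_hasDerivAt (p' := fun u => deriv p (a⁻¹ * u)) ?_ (by simp [h.map_zero])
    (by simp [h.deriv_zero]) ?_
  · filter_upwards [htendsto.eventually h.eventually_hasDerivAt] with u hu
    have hcomp := (hu.comp u (hasDerivAt_const_mul a⁻¹)).const_mul a
    rwa [mul_comm _ a⁻¹, mul_inv_cancel_left₀ ha] at hcomp
  · filter_upwards [htendsto.eventually h.deriv_sq] with u hu
    rw [hu, inv_mul_cancel_left₀ ha]

theorem invFunOn_segmentIntegral_eventuallyEq (h : IsInversionGerm P p) {r : ℝ} (hr : 0 < r)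
    (hφ : DifferentiableOn ℂ φ (ball 0 r)) (hre : ∀ z ∈ ball (0 : ℂ) r, 0 < (φ z).re)
    (hφ0 : φ 0 = 1) (hsq : ∀ z ∈ ball (0 : ℂ) r, φ z ^ 2 = (P z)⁻¹) :
    Function.invFunOn (segmentIntegral φ) (ball 0 r) =ᶠ[𝓝 0] p := by
  have hφp : ContinuousAt (fun v => (φ (p v))⁻¹) 0 := by
    have hφc : ContinuousAt φ (p 0) := by
      rw [h.map_zero]
      exact (hφ.differentiableAt (ball_mem_nhds 0 hr)).continuousAt
    exact (hφc.comp h.analyticAt.continuousAt).inv₀ (by simp [h.map_zero, hφ0])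
  have hbranch : deriv p =ᶠ[𝓝 0] fun v => (φ (p v))⁻¹ := by
    refine eventuallyEq_of_sq_eq_sq h.analyticAt.deriv.continuousAt hφp
      (by simp [h.deriv_zero, h.map_zero, hφ0]) (by simp [h.map_zero, hφ0]) ?_
    filter_upwards [h.deriv_sq, h.tendsto.eventually (ball_mem_nhds 0 hr)] with v hv hvr
    rw [hv, inv_pow, hsq _ hvr, inv_inv]
  refine _root_.invFunOn_segmentIntegral_eventuallyEq hr hφ hre h.map_zero ?_
  filter_upwards [h.eventually_hasDerivAt, hbranch] with v hv hv'
  rwa [← hv']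

theorem eventuallyEq {q : ℂ → ℂ} (hp : IsInversionGerm P p) (hq : IsInversionGerm P q)
    (hP : AnalyticAt ℂ P 0) : p =ᶠ[𝓝 0] q := by
  have hP0 : P 0 = 1 := by
    simpa [hp.map_zero, hp.deriv_zero] using hp.deriv_sq.self_of_nhds.symm
  have hre : ∀ᶠ x in 𝓝 0, 0 < (P x).re :=
    (Complex.continuous_re.continuousAt.comp hP.continuousAt).eventually_const_lt (by simp [hP0])
  obtain ⟨r, hr, hball⟩ := Metric.eventually_nhds_iff_ball.1 (hP.eventually_analyticAt.and hre)
  have hφ : DifferentiableOn ℂ (fun x => P x ^ (-(1 / 2) : ℂ)) (ball 0 r) := fun z hz =>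
    ((hball z hz).1.differentiableAt.cpow_const (.inl (hball z hz).2)).differentiableWithinAt
  have hinv {f : ℂ → ℂ} (hf : IsInversionGerm P f) :=
    hf.invFunOn_segmentIntegral_eventuallyEq hr hφ (fun z hz => re_cpow_neg_half_pos (hball z hz).2)
      (by simp [hP0]) (fun z _ => cpow_neg_half_sq (P z))
  exact (hinv hp).symm.trans (hinv hq)

theorem invFunOn_arcsl_eventuallyEq (h : IsInversionGerm (fun x => 1 - x ^ 4) p) :
    Function.invFunOn arcsl (ball 0 1) =ᶠ[𝓝 0] p := by
  have hre : ∀ z ∈ ball (0 : ℂ) 1, 0 < (1 - z ^ 4).re := fun z hz => by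
    simpa using re_one_sub_mul_pow_pos (a := 1) (n := 4) (by norm_num) (by simp)
      (mem_ball_zero_iff.1 hz)
  refine h.invFunOn_segmentIntegral_eventuallyEq one_pos (fun z hz => ?_)
    (fun z hz => re_cpow_neg_half_pos (hre z hz)) (by simp) fun z _ => cpow_neg_half_sq _
  exact (DifferentiableAt.cpow_const (f := fun t : ℂ => 1 - t ^ 4) (by fun_prop)
    (.inl (hre z hz))).differentiableWithinAt

theorem invFunOn_ellipticIntegralF_eventuallyEq {k : ℝ} (hk : |k| ≤ 1)
    (h : IsInversionGerm (fun x => (1 - x ^ 2) * (1 - (k : ℂ) ^ 2 * x ^ 2)) p) :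
    Function.invFunOn (ellipticIntegralF k) (ball 0 1) =ᶠ[𝓝 0] p := by
  have hre₁ : ∀ z ∈ ball (0 : ℂ) 1, 0 < (1 - z ^ 2).re := fun z hz => by
    simpa using re_one_sub_mul_pow_pos (a := 1) two_ne_zero (by simp) (mem_ball_zero_iff.1 hz)
  have hre₂ : ∀ z ∈ ball (0 : ℂ) 1, 0 < (1 - (k : ℂ) ^ 2 * z ^ 2).re := fun z hz =>
    re_one_sub_mul_pow_pos two_ne_zero (by simpa using hk) (mem_ball_zero_iff.1 hz)
  refine h.invFunOn_segmentIntegral_eventuallyEq one_pos (fun z hz => ?_)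
    (fun z hz => re_cpow_neg_half_mul_pos (hre₁ z hz) (hre₂ z hz)) (by simp) fun z _ => ?_
  · exact ((DifferentiableAt.cpow_const (f := fun t : ℂ => 1 - t ^ 2) (by fun_prop)
      (.inl (hre₁ z hz))).mul (DifferentiableAt.cpow_const
      (f := fun t : ℂ => 1 - (k : ℂ) ^ 2 * t ^ 2) (by fun_prop)
      (.inl (hre₂ z hz)))).differentiableWithinAt
  · rw [mul_pow, cpow_neg_half_sq, cpow_neg_half_sq, mul_inv]

end IsInversionGerm

section MeromorphicExtension

theorem eqOn_of_meromorphicNFOn_of_eventuallyEq {𝕜 E : Type*} [NontriviallyNormedField 𝕜]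
    [NormedAddCommGroup E] [NormedSpace 𝕜 E] {f g : 𝕜 → E} {U : Set 𝕜} {x : 𝕜}
    (hf : MeromorphicNFOn f U) (hg : MeromorphicNFOn g U) (hU : IsPreconnected U) (hx : x ∈ U)
    (hfg : f =ᶠ[𝓝 x] g) : EqOn f g U := by
  intro y hy
  have hmero : MeromorphicOn (f - g) U := hf.meromorphicOn.sub hg.meromorphicOn
  have hx_top : meromorphicOrderAt (f - g) x = ⊤ := by
    rw [meromorphicOrderAt_eq_top_iff]
    filter_upwards [hfg.filter_mono nhdsWithin_le_nhds] with z hz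
    simp [hz]
  have hy_top : meromorphicOrderAt (f - g) y = ⊤ := by
    by_contra hne
    exact hmero.meromorphicOrderAt_ne_top_of_isPreconnected hU hy hx hne hx_top
  have hpunctured : f =ᶠ[𝓝[≠] y] g := by
    filter_upwards [meromorphicOrderAt_eq_top_iff.1 hy_top] with z hz
    simpa [sub_eq_zero] using hz
  exact (((hf hy).eventuallyEq_nhdsNE_iff_eventuallyEq_nhds (hg hy)).1 hpunctured).self_of_nhds

theorem meromorphicNFOn_const_mul_comp_const_mul {𝕜 : Type*} [NontriviallyNormedField 𝕜]
    {g : 𝕜 → 𝕜} (hg : MeromorphicNFOn g univ) {a : 𝕜} (ha : a ≠ 0) (b : 𝕜) (U : Set 𝕜) :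
    MeromorphicNFOn (fun u => a * g (b * u)) U := fun u _ =>
  (meromorphicNFAt_mul_iff_right analyticAt_const ha).2
    ((hg (mem_univ (b * u))).comp_analyticAt (g := fun u => b * u) (by fun_prop))

/-- The germ at `0` of `f` extends to a meromorphic function on `U`. As in
`meromorphicContinuation`, the extension is required to be in normal form. -/
def HasMeromorphicExtension (f : ℂ → ℂ) (U : Set ℂ) : Prop :=
  ∃ g : ℂ → ℂ, MeromorphicNFOn g U ∧ g =ᶠ[𝓝 0] f

theorem meromorphicContinuation_eventuallyEq (f : ℂ → ℂ) :
    meromorphicContinuation f =ᶠ[𝓝 0] f := by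
  rw [meromorphicContinuation]
  split_ifs with h
  exacts [h.choose_spec.2, .rfl]

namespace HasMeromorphicExtension

variable {f g : ℂ → ℂ} {U V : Set ℂ}

theorem meromorphicNFOn_meromorphicContinuation (h : HasMeromorphicExtension f univ) :
    MeromorphicNFOn (meromorphicContinuation f) univ := by
  have hex : ∃ g : ℂ → ℂ, MeromorphicNFOn g univ ∧ g =ᶠ[𝓝 0] f := h
  rw [meromorphicContinuation, dif_pos hex]
  exact hex.choose_spec.1

theorem congr (h : HasMeromorphicExtension f U) (hfg : f =ᶠ[𝓝 0] g) :
    HasMeromorphicExtension g U := by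
  obtain ⟨F, hF, hFf⟩ := h
  exact ⟨F, hF, hFf.trans hfg⟩

theorem mono (h : HasMeromorphicExtension f V) (hUV : U ⊆ V) : HasMeromorphicExtension f U := by
  obtain ⟨F, hF, hFf⟩ := h
  exact ⟨F, fun z hz => hF (hUV hz), hFf⟩

theorem of_meromorphicOn (h0 : 0 ∈ U) (hg : MeromorphicOn g U) (hgf : g =ᶠ[𝓝 0] f)
    (hf : AnalyticAt ℂ f 0) : HasMeromorphicExtension f U := by
  have hnf : MeromorphicNFOn (toMeromorphicNFOn g U) U := meromorphicNFOn_toMeromorphicNFOn g U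
  refine ⟨toMeromorphicNFOn g U, hnf, ((hnf h0).eventuallyEq_nhdsNE_iff_eventuallyEq_nhds
    hf.meromorphicNFAt).1 ?_⟩
  exact (hg.toMeromorphicNFOn_eq_self_on_nhdsNE h0).trans (hgf.filter_mono nhdsWithin_le_nhds)

theorem univ_of_forall_ball (h : ∀ R : ℝ, HasMeromorphicExtension f (ball 0 R)) :
    HasMeromorphicExtension f univ := by
  choose G hG hGf using h
  have hglue : ∀ R, EqOn (fun z => G (‖z‖ + 1) z) (G R) (ball 0 R) := by
    intro R z hz
    have hzR : z ∈ ball (0 : ℂ) (min (‖z‖ + 1) R) := by simpa using hz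
    exact eqOn_of_meromorphicNFOn_of_eventuallyEq
      (fun w hw => hG _ (ball_subset_ball (min_le_left _ _) hw))
      (fun w hw => hG R (ball_subset_ball (min_le_right _ _) hw)) (convex_ball 0 _).isPreconnected
      (mem_ball_self (pos_of_mem_ball hzR)) ((hGf _).trans (hGf R).symm) hzR
  refine ⟨fun z => G (‖z‖ + 1) z, fun z _ => ?_, ?_⟩
  · have hz : z ∈ ball (0 : ℂ) (‖z‖ + 1) := by simp
    exact (meromorphicNFAt_congr ((hglue _).eventuallyEq_of_mem (isOpen_ball.mem_nhds hz))).2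
      (hG _ hz)
  · exact ((hglue 1).eventuallyEq_of_mem (ball_mem_nhds 0 one_pos)).trans (hGf 1)

theorem scale (h : HasMeromorphicExtension f univ) {a : ℂ} (ha : a ≠ 0) (b : ℂ) :
    HasMeromorphicExtension (fun u => a * f (b * u)) univ := by
  obtain ⟨F, hF, hFf⟩ := h
  refine ⟨fun u => a * F (b * u), meromorphicNFOn_const_mul_comp_const_mul hF ha b univ, ?_⟩
  filter_upwards [((continuous_const_mul b).tendsto' 0 0 (mul_zero b)).eventually hFf] with u hu
  rw [hu]

theorem eq_inv_mul_meromorphicContinuation (h : HasMeromorphicExtension g univ)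
    (hU : IsPreconnected U) (h0 : 0 ∈ U) (hg : AnalyticOnNhd ℂ g U) {a : ℂ} (ha : a ≠ 0)
    (hf : f =ᶠ[𝓝 0] fun u => a * g (a⁻¹ * u)) {z : ℂ} (hz : z ∈ U) :
    g z = a⁻¹ * meromorphicContinuation f (a * z) := by
  have hnf := ((h.scale ha a⁻¹).congr hf.symm).meromorphicNFOn_meromorphicContinuation
  have hgerm : g =ᶠ[𝓝 0] fun z => a⁻¹ * meromorphicContinuation f (a * z) := by
    filter_upwards [((continuous_const_mul a).tendsto' 0 0 (mul_zero a)).eventually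
      ((meromorphicContinuation_eventuallyEq f).trans hf)] with z hz
    rw [hz, inv_mul_cancel_left₀ ha, inv_mul_cancel_left₀ ha]
  exact eqOn_of_meromorphicNFOn_of_eventuallyEq hg.meromorphicNFOn
    (meromorphicNFOn_const_mul_comp_const_mul hnf (inv_ne_zero ha) a U) hU h0 hgerm hz

end HasMeromorphicExtension

end MeromorphicExtension

namespace IsInversionGerm

section Lemniscatic

variable {a : ℂ} {p : ℂ → ℂ}

theorem eventually_one_add_ne_zero {n : ℕ} {P : ℂ → ℂ} (h : IsInversionGerm P p) (a : ℂ)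
    (hn : n ≠ 0) : ∀ᶠ v in 𝓝 0, 1 + a * p v ^ n ≠ 0 :=
  (continuousAt_const.add (continuousAt_const.mul (h.analyticAt.continuousAt.pow n))).eventually_ne
    (by simp [h.map_zero, hn])

theorem mul_deriv_div (h : IsInversionGerm (fun x => 1 - a * x ^ 4) p) :
    IsInversionGerm (fun x => 1 - a * (2 * x) ^ 4)
      (fun v => p v * deriv p v / (1 + a * p v ^ 4)) := by
  have hP : ∀ x, HasDerivAt (fun x : ℂ => 1 - a * x ^ 4) (-(4 * a * x ^ 3)) x := fun x => by
    refine (((hasDerivAt_pow 4 x).const_mul a).const_sub 1).congr_deriv ?_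
    push_cast
    ring
  refine of_eventually_hasDerivAt
    (p' := fun v => (1 - 6 * (a * p v ^ 4) + (a * p v ^ 4) ^ 2) / (1 + a * p v ^ 4) ^ 2)
    ?_ (by simp [h.map_zero]) (by simp [h.map_zero]) ?_
  · filter_upwards [h.eventually_hasDerivAt, h.eventually_hasDerivAt_deriv (.of_forall hP),
      h.deriv_sq, h.eventually_one_add_ne_zero a four_ne_zero] with v hp hp' hsq hne
    refine ((hp.mul hp').div (((hp.pow 4).const_mul a).const_add 1) hne).congr_deriv ?_
    congr 1
    simp only [Pi.mul_apply, Pi.pow_apply]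
    push_cast
    linear_combination (1 - 3 * a * p v ^ 4) * hsq
  · filter_upwards [h.deriv_sq, h.eventually_one_add_ne_zero a four_ne_zero] with v hsq hne
    have hquot : 1 - a * (2 * (p v * deriv p v / (1 + a * p v ^ 4))) ^ 4 =
        1 - 16 * (a * p v ^ 4) * (deriv p v ^ 2) ^ 2 / (1 + a * p v ^ 4) ^ 4 := by
      rw [mul_pow, div_pow]
      ring
    rw [hquot, hsq]
    field_simp
    ring

theorem duplication (h : IsInversionGerm (fun x => 1 - a * x ^ 4) p) :
    p =ᶠ[𝓝 0] fun v =>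
      2 * (p (2⁻¹ * v) * deriv p (2⁻¹ * v) / (1 + a * p (2⁻¹ * v) ^ 4)) := by
  have hdouble := h.mul_deriv_div.scale two_ne_zero
  simp only [mul_inv_cancel_left₀ (two_ne_zero' ℂ)] at hdouble
  exact h.eventuallyEq hdouble (by fun_prop)

theorem hasMeromorphicExtension_ball_two_mul (h : IsInversionGerm (fun x => 1 - a * x ^ 4) p)
    {R : ℝ} (hR : 0 < R) (hext : HasMeromorphicExtension p (ball 0 R)) :
    HasMeromorphicExtension p (ball 0 (2 * R)) := by
  obtain ⟨g, hg, hgp⟩ := hext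
  have hhalf {G : ℂ → ℂ} (hG : MeromorphicOn G (ball 0 R)) :
      MeromorphicOn (fun v => G (2⁻¹ * v)) (ball 0 (2 * R)) := fun v hv => by
    have hv' : 2⁻¹ * v ∈ ball (0 : ℂ) R := by
      rw [mem_ball_zero_iff] at hv ⊢
      rw [norm_mul, norm_inv, Complex.norm_ofNat]
      linarith
    exact (hG _ hv').comp_analyticAt (g := fun v => 2⁻¹ * v) (by fun_prop)
  have hmero := hhalf (G := fun w => 2 * (g w * deriv g w / (1 + a * g w ^ 4)))
    ((MeromorphicOn.const 2).mul ((hg.meromorphicOn.mul hg.meromorphicOn.deriv).div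
      ((MeromorphicOn.const 1).add ((MeromorphicOn.const a).mul (hg.meromorphicOn.pow 4)))))
  refine .of_meromorphicOn (mem_ball_self (by positivity)) hmero ?_ h.analyticAt
  refine EventuallyEq.trans ?_ h.duplication.symm
  filter_upwards [((continuous_const_mul (2⁻¹ : ℂ)).tendsto' 0 0 (mul_zero _)).eventually
    (hgp.and hgp.deriv)] with v hv
  rw [hv.1, hv.2]

theorem hasMeromorphicExtension_univ (h : IsInversionGerm (fun x => 1 - a * x ^ 4) p) :
    HasMeromorphicExtension p univ := by
  obtain ⟨r, hr, hp⟩ := Metric.eventually_nhds_iff_ball.1 h.analyticAt.eventually_analyticAt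
  have hpow : ∀ n : ℕ, HasMeromorphicExtension p (ball 0 (2 ^ n * r)) := by
    intro n
    induction n with
    | zero => exact ⟨p, fun z hz => (hp z (by simpa using hz)).meromorphicNFAt, .rfl⟩
    | succ n ih =>
      rw [pow_succ', mul_assoc]
      exact h.hasMeromorphicExtension_ball_two_mul (by positivity) ih
  refine .univ_of_forall_ball fun R => ?_
  obtain ⟨n, hn⟩ := pow_unbounded_of_one_lt (R / r) (one_lt_two (α := ℝ))
  exact (hpow n).mono (ball_subset_ball ((div_lt_iff₀ hr).1 hn).le)

end Lemniscatic

section JacobiSd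

variable {q : ℂ → ℂ}

theorem eventually_re_one_add_pos {P : ℂ → ℂ} (h : IsInversionGerm P q) (k : ℂ) :
    ∀ᶠ v in 𝓝 0, 0 < (1 + k ^ 2 * q v ^ 2).re := by
  have hcont : ContinuousAt (fun v => (1 + k ^ 2 * q v ^ 2).re) 0 := by
    have := h.analyticAt.continuousAt
    fun_prop
  exact hcont.eventually_const_lt (by simp [h.map_zero])

theorem sn_of_sd {k : ℂ}
    (h : IsInversionGerm (fun x => (1 - (1 - k ^ 2) * x ^ 2) * (1 + k ^ 2 * x ^ 2)) q) :
    IsInversionGerm (fun x => (1 - x ^ 2) * (1 - k ^ 2 * x ^ 2))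
      (fun v => q v * (1 + k ^ 2 * q v ^ 2) ^ (-(1 / 2) : ℂ)) := by
  have hne {w : ℂ} (hw : 0 < w.re) : w ≠ 0 := fun h => by simp [h] at hw
  refine of_eventually_hasDerivAt (p' := fun v =>
    deriv q v * (1 + k ^ 2 * q v ^ 2) ^ (-(1 / 2) : ℂ) * (1 + k ^ 2 * q v ^ 2)⁻¹)
    ?_ (by simp [h.map_zero]) (by simp [h.map_zero, h.deriv_zero]) ?_
  · filter_upwards [h.eventually_hasDerivAt, h.eventually_re_one_add_pos k] with v hq hre
    have hroot := (((hq.pow 2).const_mul (k ^ 2)).const_add 1).cpow_const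
      (c := -(1 / 2)) (.inl hre)
    refine (hq.mul hroot).congr_deriv ?_
    have hw := hne hre
    simp only [Pi.pow_apply, Complex.cpow_sub _ _ hw, Complex.cpow_one]
    push_cast
    linear_combination
      -(deriv q v * (1 + k ^ 2 * q v ^ 2) ^ (-(1 / 2) : ℂ)) * mul_inv_cancel₀ hw
  · filter_upwards [h.deriv_sq, h.eventually_re_one_add_pos k] with v hsq hre
    have := hne hre
    simp only [mul_pow, cpow_neg_half_sq, hsq]
    field_simp
    ring

theorem jacobiSn_eventuallyEq {k : ℝ} (hk : |k| ≤ 1)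
    (h : IsInversionGerm (fun x => (1 - (1 - (k : ℂ) ^ 2) * x ^ 2) * (1 + (k : ℂ) ^ 2 * x ^ 2)) q) :
    jacobiSn k =ᶠ[𝓝 0] fun v => q v * (1 + (k : ℂ) ^ 2 * q v ^ 2) ^ (-(1 / 2) : ℂ) :=
  (meromorphicContinuation_eventuallyEq _).trans
    (h.sn_of_sd.invFunOn_ellipticIntegralF_eventuallyEq hk)

theorem jacobiDn_eventuallyEq {k : ℝ} (hk : |k| ≤ 1)
    (h : IsInversionGerm (fun x => (1 - (1 - (k : ℂ) ^ 2) * x ^ 2) * (1 + (k : ℂ) ^ 2 * x ^ 2)) q) :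
    jacobiDn k =ᶠ[𝓝 0] fun v => (1 + (k : ℂ) ^ 2 * q v ^ 2) ^ (-(1 / 2) : ℂ) := by
  refine (meromorphicContinuation_eventuallyEq _).trans ?_
  filter_upwards [h.jacobiSn_eventuallyEq hk, h.eventually_re_one_add_pos k] with v hsn hre
  have hne : 1 + (k : ℂ) ^ 2 * q v ^ 2 ≠ 0 := fun h => by simp [h] at hre
  have hdn_sq : 1 - (k : ℂ) ^ 2 * jacobiSn k v ^ 2 = (1 + (k : ℂ) ^ 2 * q v ^ 2)⁻¹ := by
    rw [hsn, mul_pow, cpow_neg_half_sq]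
    field_simp
    ring
  rw [hdn_sq, inv_cpow_half hre]

theorem jacobiSn_div_jacobiDn_eventuallyEq {k : ℝ} (hk : |k| ≤ 1)
    (h : IsInversionGerm (fun x => (1 - (1 - (k : ℂ) ^ 2) * x ^ 2) * (1 + (k : ℂ) ^ 2 * x ^ 2)) q) :
    (fun v => jacobiSn k v / jacobiDn k v) =ᶠ[𝓝 0] q := by
  filter_upwards [h.jacobiSn_eventuallyEq hk, h.jacobiDn_eventuallyEq hk,
    h.eventually_re_one_add_pos k] with v hsn hdn hre
  have hne : (1 + (k : ℂ) ^ 2 * q v ^ 2) ^ (-(1 / 2) : ℂ) ≠ 0 := fun h => by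
    simpa only [h, Complex.zero_re, lt_self_iff_false] using re_cpow_neg_half_pos hre
  rw [hsn, hdn, mul_div_cancel_right₀ _ hne]

end JacobiSd

section Scaled

variable {q : ℂ → ℂ} {U : Set ℂ} {z : ℂ}

theorem eq_sl (h : IsInversionGerm (fun x => 1 - 4 * x ^ 4) q) (hU : IsPreconnected U)
    (h0 : 0 ∈ U) (hq : AnalyticOnNhd ℂ q U) (hz : z ∈ U) :
    q z = 1 / (Real.sqrt 2 : ℂ) * sl ((Real.sqrt 2 : ℂ) * z) := by
  have hsqrt : (Real.sqrt 2 : ℂ) ≠ 0 := by simp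
  have hsqrt_pow : (Real.sqrt 2 : ℂ) ^ 4 = 4 := by
    norm_cast
    rw [show 4 = 2 * 2 from rfl, pow_mul, Real.sq_sqrt zero_le_two]
    norm_num
  have hscale := h.scale hsqrt
  simp only [mul_pow, inv_pow, hsqrt_pow,
    mul_inv_cancel_left₀ (by norm_num : (4 : ℂ) ≠ 0)] at hscale
  rw [one_div]
  exact h.hasMeromorphicExtension_univ.eq_inv_mul_meromorphicContinuation hU h0 hq hsqrt
    hscale.invFunOn_arcsl_eventuallyEq hz

theorem eq_jacobiSd (h : IsInversionGerm (fun x => 1 - 4 * x ^ 4) q) (hU : IsPreconnected U)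
    (h0 : 0 ∈ U) (hq : AnalyticOnNhd ℂ q U) (hz : z ∈ U) :
    q z = 1 / 2 * jacobiSd (1 / Real.sqrt 2) (2 * z) := by
  have hk : |1 / Real.sqrt 2| ≤ 1 := by
    rw [abs_of_nonneg (by positivity), div_le_one (by positivity)]
    exact Real.one_le_sqrt.2 one_le_two
  have hk_sq : ((1 / Real.sqrt 2 : ℝ) : ℂ) ^ 2 = 1 / 2 := by
    norm_cast
    rw [div_pow, Real.sq_sqrt zero_le_two]
    norm_num
  have hscale : IsInversionGerm (fun x => (1 - (1 - ((1 / Real.sqrt 2 : ℝ) : ℂ) ^ 2) * x ^ 2) *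
      (1 + ((1 / Real.sqrt 2 : ℝ) : ℂ) ^ 2 * x ^ 2)) (fun u => 2 * q (2⁻¹ * u)) := by
    convert h.scale two_ne_zero using 2 with x
    rw [hk_sq]
    ring
  rw [one_div (2 : ℂ)]
  exact h.hasMeromorphicExtension_univ.eq_inv_mul_meromorphicContinuation hU h0 hq two_ne_zero
    (hscale.jacobiSn_div_jacobiDn_eventuallyEq hk) hz

end Scaled

end IsInversionGerm

namespace IsCubicSolutionOn

variable {s c : ℂ → ℂ} {U : Set ℂ}

theorem eventually_pow_four_add_pow_four (h : IsCubicSolutionOn s c U) (hU : U ∈ 𝓝 0) :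
    ∀ᶠ z in 𝓝 0, c z ^ 4 + s z ^ 4 = 1 := by
  refine eventuallyEq_of_eventually_hasDerivAt (f' := 0) ?_
    (.of_forall fun z => hasDerivAt_const z 1) (by simp [h.s_zero, h.c_zero])
  filter_upwards [hU] with z hz
  refine (((h.deriv_c z hz).pow 4).add ((h.deriv_s z hz).pow 4)).congr_deriv ?_
  push_cast
  simp only [Pi.zero_apply]
  ring

theorem isInversionGerm_mul (h : IsCubicSolutionOn s c U) (hU : U ∈ 𝓝 0) :
    IsInversionGerm (fun x => 1 - 4 * x ^ 4) (fun z => s z * c z) := by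
  refine .of_eventually_hasDerivAt (p' := fun z => c z ^ 4 - s z ^ 4) ?_ (by simp [h.s_zero])
    (by simp [h.s_zero, h.c_zero]) ?_
  · filter_upwards [hU] with z hz
    exact ((h.deriv_s z hz).mul (h.deriv_c z hz)).congr_deriv (by ring)
  · filter_upwards [h.eventually_pow_four_add_pow_four hU] with z hz
    linear_combination (c z ^ 4 + s z ^ 4 + 1) * hz

theorem analyticOnNhd_mul (h : IsCubicSolutionOn s c U) (hU : IsOpen U) :
    AnalyticOnNhd ℂ (fun z => s z * c z) U :=
  DifferentiableOn.analyticOnNhd (fun z hz => ((h.deriv_s z hz).mul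
    (h.deriv_c z hz)).differentiableAt.differentiableWithinAt) hU

end IsCubicSolutionOn

theorem theorem5_general {s c : ℂ → ℂ} {U : Set ℂ} (hU : IsOpen U) (hconn : IsPreconnected U)
    (h0 : 0 ∈ U) (hsc : IsCubicSolutionOn s c U) {z : ℂ} (hz : z ∈ U) :
    s z * c z = 1 / (Real.sqrt 2 : ℂ) * sl ((Real.sqrt 2 : ℂ) * z) ∧
    s z * c z = 1 / 2 * jacobiSd (1 / Real.sqrt 2) (2 * z) := by
  have hgerm := hsc.isInversionGerm_mul (hU.mem_nhds h0)
  have hana := hsc.analyticOnNhd_mul hU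
  exact ⟨hgerm.eq_sl hconn h0 hana hz, hgerm.eq_jacobiSd hconn h0 hana hz⟩

theorem theorem5 (s c : ℂ → ℂ)
    (hsc : IsCubicSolutionOn s c (Metric.ball 0 (4 / 27)))
    (z : ℂ) (hz : ‖z‖ < 4 / 27) :
    s z * c z = 1 / (Real.sqrt 2 : ℂ) * sl ((Real.sqrt 2 : ℂ) * z) ∧
    s z * c z = 1 / 2 * jacobiSd (1 / Real.sqrt 2) (2 * z) :=
  theorem5_general isOpen_ball (convex_ball 0 _).isPreconnected (mem_ball_self (by norm_num)) hsc
    (mem_ball_zero_iff.2 hz)
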